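/- Let $n\ge 1$, let $M$ be a real $n\times n$ matrix, and let $U\subset\mathbb{R}^n$ be open and simply connected (in particular non-empty and path-connected). Let $A\subset M_{n\times n}(\mathbb{R})$ be the unital algebra generated by $M^{\intercal}$, and regard $B=\mathbb{R}^n$ as an $A$-module through the action of matrices on vectors. A function $f\colon U\to A$ is called $A$-analytic if every $b_0\in U$ has an open neighbourhood $V\subset U$ on which $f(b)=\sum_{i=0}^{\infty}L_i(b-b_0,\dotsc,b-b_0)$ for some symmetric $A$-multilinear maps $L_i\colon B^i\to A$ such that $\sum_{i=0}^{\infty}\|L_i(b-b_0,\dotsc,b-b_0)\|<\infty$ for all $b\in V$. A function $v\colon U\to\mathbb{R}$ is called a component of $f$ if $v=\psi\circ f$ for some $\mathbb{R}$-linear functional $\psi\colon A\to\mathbb{R}$. The following conditions are equivalent: (i) any functions $v,w\colon U\to\mathbb{R}$ of class $C^2$ which satisfy $Dw(b)(x)=Dv(b)(M^{\intercal}x)$ for all $b\in U$ and $x\in\mathbb{R}^n$ are real-analytic, and each of them is a component of some $A$-analytic function on $U$; (ii) $M$ has no real eigenvalues. -/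

import Mathlib

open scoped Matrix

/- The natural action of matrices on column vectors, `a • x = a *ᵥ x`; subalgebras of the matrix
algebra inherit it. -/
attribute [local instance] Matrix.Module.matrixModule

/- A norm on the matrix algebra, inherited by its subalgebras. All norms are equivalent here; it is
used only to express convergence of series. -/
attribute [local instance] Matrix.linftyOpNormedRing

/-- The unital subalgebra of `M_n(ℝ)` generated by a single matrix. Through the inherited action,
`ℝⁿ` is a module over it. -/
abbrev MatAlg {n : ℕ} (N : Matrix (Fin n) (Fin n) ℝ) :
    Subalgebra ℝ (Matrix (Fin n) (Fin n) ℝ) :=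
  Algebra.adjoin ℝ {N}

/-- `f : U → A` (with `U ⊆ B`, `B` an `A`-module) is `A`-analytic: near every point `b₀` of `U` it
is the sum of an absolutely convergent series `∑ᵢ Lᵢ(b - b₀, …, b - b₀)` where each
`Lᵢ : Bⁱ → A` is symmetric and `A`-multilinear. -/
def IsAAnalyticOn {A B : Type*} [NormedRing A] [NormedAddCommGroup B] [Module A B]
    (f : B → A) (U : Set B) : Prop :=
  ∀ b₀ ∈ U, ∃ V : Set B, IsOpen V ∧ b₀ ∈ V ∧ V ⊆ U ∧
    ∃ L : (i : ℕ) → MultilinearMap A (fun _ : Fin i => B) A,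
      (∀ (i : ℕ) (σ : Equiv.Perm (Fin i)) (x : Fin i → B), L i (fun j => x (σ j)) = L i x) ∧
      ∀ b ∈ V,
        Summable (fun i : ℕ => ‖L i (fun _ => b - b₀)‖) ∧
        HasSum (fun i : ℕ => L i (fun _ => b - b₀)) (f b)

/-- `v : U → ℝ` is a component of an `A`-analytic function: `v = ψ ∘ f` on `U` for some
`A`-analytic `f : U → A` and some `ℝ`-linear functional `ψ : A → ℝ`. -/
def IsComponentOfAAnalyticOn (A : Type*) {B : Type*} [NormedRing A] [Module ℝ A]
    [NormedAddCommGroup B] [Module A B] (v : B → ℝ) (U : Set B) : Prop :=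
  ∃ (f : B → A) (ψ : A →ₗ[ℝ] ℝ), IsAAnalyticOn f U ∧ ∀ b ∈ U, v b = ψ (f b)

/-! Differentiating `Dw = Dv ∘ Mᵀ` and using the symmetry of both Hessians shows that `Mᵀ`, hence
the commutative algebra `A` it generates, is selfadjoint for `D²v`; likewise for `D²w`. From here on
`v` and `w` are treated alike and separately. `A` has a Frobenius functional `ψ`
(`exists_frobenius_form`), so `Dv` lifts to a unique `A`-valued form `ω`, `A`-linear in `x`, with `ψ
(c * ω x) = Dv (c • x)`. Selfadjointness makes `ω` closed, and simple connectedness provides a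
primitive `f : U → A` (`IsSimplyConnected.exists_primitive`); then `ψ ∘ f` is `v` up to a constant.

If `M` has no real eigenvalue, every residue field of `A` is `ℂ`, so `A` contains `J` with `J² = -1`
(`exists_dvd_sq_add_one`). As `Df` commutes with `J`, `f` is holomorphic in complex coordinates and
Osgood's lemma makes it real-analytic. Its Taylor terms are `A`-multilinear because `Df` is
`A`-linear.

Conversely, an eigenvector `u` of `M` with real eigenvalue `μ` gives the form `l x = u ⬝ᵥ x` with `l
(Mᵀ x) = μ * l x`. Every smooth `g` then yields an admissible pair `g ∘ l`, `μ * (g ∘ l)`, and `g`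
need not be analytic. -/

/-! ### Algebra: square roots of `-1` and Frobenius forms. -/

open Polynomial in
/-- A real polynomial without real roots divides `p ^ 2 + 1` for some `p`. -/
theorem exists_dvd_sq_add_one (m : ℝ[X]) (hm : m ≠ 0) (hr : ∀ μ : ℝ, ¬ m.IsRoot μ) :
    ∃ p : ℝ[X], m ∣ p ^ 2 + 1 := by
  let R := AdjoinRoot m
  have : FiniteDimensional ℝ R := (AdjoinRoot.powerBasis hm).finite
  have : IsArtinianRing R := IsArtinianRing.of_finite ℝ R
  -- A residue field is `ℝ` or `ℂ`; the former would send the class of `X` to a real root of `m`.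
  have hz : ∀ I : MaximalSpectrum R, ∃ z : R ⧸ I.asIdeal, z ^ 2 + 1 = 0 := by
    intro I
    have := I.isMaximal
    let : Field (R ⧸ I.asIdeal) := Ideal.Quotient.field I.asIdeal
    have : FiniteDimensional ℝ (R ⧸ I.asIdeal) := inferInstance
    have : Algebra.IsAlgebraic ℝ (R ⧸ I.asIdeal) := Algebra.IsAlgebraic.of_finite _ _
    rcases Real.nonempty_algEquiv_or (R ⧸ I.asIdeal) with ⟨⟨e⟩⟩ | ⟨⟨e⟩⟩
    · exfalso
      let g : R →ₐ[ℝ] ℝ := e.toAlgHom.comp (Ideal.Quotient.mkₐ ℝ I.asIdeal)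
      refine hr (g (AdjoinRoot.root m)) ?_
      have h : aeval (AdjoinRoot.root m) m = 0 := by
        rw [AdjoinRoot.aeval_eq, AdjoinRoot.mk_self]
      have h2 := congrArg g h
      rw [map_zero, ← aeval_algHom_apply] at h2
      simpa [IsRoot, aeval_def] using h2
    · refine ⟨e.symm Complex.I, e.injective ?_⟩
      simp
  choose z hz using hz
  -- The reduced quotient is the product of the residue fields, so the roots combine into one root
  -- modulo nilpotents.
  obtain ⟨y, hy⟩ := (IsArtinianRing.quotNilradicalEquivPi R).surjective z
  obtain ⟨x, rfl⟩ := Ideal.Quotient.mk_surjective y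
  have hx : IsNilpotent (x ^ 2 + 1) := by
    rw [← mem_nilradical, ← Ideal.Quotient.eq_zero_iff_mem]
    apply (IsArtinianRing.quotNilradicalEquivPi R).injective
    rw [map_add, map_pow, map_add, map_pow, hy, map_one, map_one, map_zero]
    funext I
    exact hz I
  have hx2 : IsUnit (x ^ 2) := by
    have := hx.isUnit_sub_one
    simpa using this
  have hxu : IsUnit x := (isUnit_pow_iff two_ne_zero).1 hx2
  -- Newton's method removes the nilpotent error, the derivative `2 * x` being a unit.
  obtain ⟨r, ⟨-, hr0⟩, -⟩ := existsUnique_nilpotent_sub_and_aeval_eq_zero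
    (R := ℝ) (P := X ^ 2 + 1) (x := x) (by simpa using hx) (by
      have : IsUnit (algebraMap ℝ R (1 + 1)) := (isUnit_iff_ne_zero.2 (by norm_num)).map _
      rw [map_add, map_one] at this
      simpa using this.mul hxu)
  obtain ⟨p, rfl⟩ := AdjoinRoot.mk_surjective r
  refine ⟨p, AdjoinRoot.mk_eq_zero.1 ?_⟩
  simpa using hr0

/-- The algebra generated by one element is Frobenius: some functional `ψ` makes
`(c, a) ↦ ψ (c * a)` a perfect pairing. -/
theorem exists_frobenius_form {R : Type*} [Ring R] [Algebra ℝ R] [FiniteDimensional ℝ R]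
    [Nontrivial R] (N : R) :
    ∃ (ψ : Algebra.adjoin ℝ {N} →ₗ[ℝ] ℝ)
      (Φ : Algebra.adjoin ℝ {N} ≃ₗ[ℝ] Module.Dual ℝ (Algebra.adjoin ℝ {N})),
      (∀ a c, Φ a c = ψ (c * a)) ∧ ∃ a, ψ a = 1 := by
  classical
  set d := (minpoly ℝ N).natDegree with hd
  have hint : IsIntegral ℝ N := Algebra.IsIntegral.isIntegral N
  have hdpos : 0 < d := minpoly.natDegree_pos hint
  have hli : LinearIndependent ℝ (fun i : Fin d => N ^ (i : ℕ)) := linearIndependent_pow N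
  -- On the algebra, `ψ₀` reads off the coefficient of the top power `N ^ (d - 1)`.
  obtain ⟨ψ₀, hψ₀⟩ : ∃ ψ₀ : R →ₗ[ℝ] ℝ, ∀ i : Fin d,
      ψ₀ (N ^ (i : ℕ)) = if (i : ℕ) = d - 1 then 1 else 0 := by
    let b := Module.Basis.sumExtend hli
    refine ⟨b.constr ℝ (Sum.elim (fun i : Fin d => if (i : ℕ) = d - 1 then 1 else 0) 0), fun i => ?_⟩
    have : b (Sum.inl i) = N ^ (i : ℕ) := by
      simp only [b, Module.Basis.sumExtend, Module.Basis.reindex_apply,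
        Module.Basis.extend_apply_self]
      rfl
    rw [← this, Module.Basis.constr_basis]
    rfl
  let ψ : Algebra.adjoin ℝ {N} →ₗ[ℝ] ℝ := ψ₀ ∘ₗ (Algebra.adjoin ℝ {N}).val.toLinearMap
  let Φ₀ : Algebra.adjoin ℝ {N} →ₗ[ℝ] Module.Dual ℝ (Algebra.adjoin ℝ {N}) :=
    (LinearMap.mul ℝ _).flip.compr₂ ψ
  have hN : N ∈ Algebra.adjoin ℝ {N} := Algebra.self_mem_adjoin_singleton ℝ N
  have hinj : Function.Injective Φ₀ := by
    rw [← LinearMap.ker_eq_bot, LinearMap.ker_eq_bot']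
    rintro ⟨a, ha⟩ h
    rw [Algebra.adjoin_singleton_eq_range_aeval] at ha
    obtain ⟨q, rfl⟩ := ha
    have hmod := Polynomial.aeval_modByMonic_eq_self_of_root (p := q) (minpoly.aeval ℝ N)
    set p := q %ₘ minpoly ℝ N with hp
    have hpd : p.natDegree < d := by
      apply Polynomial.natDegree_modByMonic_lt _ (minpoly.monic hint)
      exact minpoly.ne_one ℝ N
    by_cases hp0 : p = 0
    · apply Subtype.ext
      simpa [hp0] using hmod.symm
    exfalso
    -- Multiplication by this power moves the leading term of `p` to degree `d - 1`, so `ψ₀` returns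
    -- its leading coefficient.
    have h1 := LinearMap.congr_fun h ⟨N ^ (d - 1 - p.natDegree), pow_mem hN _⟩
    have h2 : ψ₀ (N ^ (d - 1 - p.natDegree) * Polynomial.aeval N q) = 0 := h1
    rw [← hmod, Polynomial.aeval_eq_sum_range, Finset.mul_sum, map_sum,
      Finset.sum_eq_single_of_mem p.natDegree (by simp)] at h2
    · rw [mul_smul_comm, ← pow_add, map_smul] at h2
      have := hψ₀ ⟨d - 1, by omega⟩
      rw [show d - 1 - p.natDegree + p.natDegree = d - 1 by omega] at h2
      simp only [if_true] at this
      rw [this] at h2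
      simp [hp0] at h2
    · intro i hi hne
      rw [mul_smul_comm, ← pow_add, map_smul]
      have hi' : i < p.natDegree := by
        have := Finset.mem_range.1 hi
        omega
      have := hψ₀ ⟨d - 1 - p.natDegree + i, by omega⟩
      rw [if_neg (by simp only; omega)] at this
      simp only at this
      rw [this, smul_zero]
  refine ⟨ψ, LinearEquiv.ofInjectiveOfFinrankEq Φ₀ hinj (by
    rw [Subspace.dual_finrank_eq]), ?_, ⟨⟨N ^ (d - 1), pow_mem hN _⟩, ?_⟩⟩
  · intro a c
    rfl
  · exact (hψ₀ ⟨d - 1, by omega⟩).trans (if_pos rfl)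

/-! ### Closed forms on simply connected sets. -/

/-- **Poincaré lemma** on open simply connected sets: a differentiable `1`-form with symmetric
derivative has a primitive. -/
theorem IsSimplyConnected.exists_primitive {E F : Type*} [NormedAddCommGroup E] [NormedSpace ℝ E]
    [NormedAddCommGroup F] [NormedSpace ℝ F] [CompleteSpace F] {U : Set E}
    (hUc : IsSimplyConnected U) (hUo : IsOpen U) {ω : E → E →L[ℝ] F}
    (hω : DifferentiableOn ℝ ω U)
    (hsymm : ∀ a ∈ U, ∀ x y, fderiv ℝ ω a x y = fderiv ℝ ω a y x) :
    ∃ f : E → F, ∀ a ∈ U, HasFDerivAt f (ω a) a := by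
  classical
  have := hUc.simplyConnectedSpace
  have := hUo.locallyPathConnectedSpace
  have hball : ∀ x : U, ∃ r > 0, Metric.ball (x : E) r ⊆ U := fun x =>
    Metric.isOpen_iff.1 hUo x x.2
  choose r hr hrU using hball
  have hprim : ∀ x : U, ∃ g : E → F, ∀ a ∈ Metric.ball (x : E) (r x), HasFDerivAt g (ω a) a :=
    fun x => (convex_ball (x : E) (r x)).exists_forall_hasFDerivAt_of_fderiv_symmetric
      Metric.isOpen_ball (hω.mono (hrU x)) fun a ha => hsymm a (hrU x ha)
  choose g hg using hprim
  -- A copy of `F` that can carry the discrete topology beside the norm topology of `F`.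
  let D := {_d : F // True}
  let : TopologicalSpace D := ⊥
  have : DiscreteTopology D := ⟨rfl⟩
  let mk : F → D := fun c => ⟨c, trivial⟩
  have hloc : ∀ i j : U, IsOpen (Metric.ball (i : E) (r i) ∩ Metric.ball (j : E) (r j)) :=
    fun i j => Metric.isOpen_ball.inter Metric.isOpen_ball
  have hconst : ∀ i j : U, ∀ a ∈ Metric.ball (i : E) (r i) ∩ Metric.ball (j : E) (r j),
      ∀ b ∈ Metric.ball (i : E) (r i) ∩ Metric.ball (j : E) (r j),
      g i a - g j a = g i b - g j b := by
    intro i j a ha b hb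
    have hd : ∀ c ∈ Metric.ball (i : E) (r i) ∩ Metric.ball (j : E) (r j),
        HasFDerivAt (fun c => g i c - g j c) (0 : E →L[ℝ] F) c := by
      intro c hc
      have := (hg i c hc.1).sub (hg j c hc.2)
      rwa [sub_self] at this
    exact ((convex_ball _ _).inter (convex_ball _ _)).is_const_of_fderivWithin_eq_zero (𝕜 := ℝ)
      (fun c hc => (hd c hc).differentiableAt.differentiableWithinAt)
      (fun c hc => by
        rw [fderivWithin_of_isOpen (hloc i j) hc]; exact (hd c hc).fderiv) ha hb
  -- The covering space of germs of primitives: `c` in chart `i` stands for `g i + c`, and the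
  -- transition functions are locally constant by `hconst`.
  let Z : FiberBundleCore U U D :=
    { baseSet := fun i => {x : U | (x : E) ∈ Metric.ball (i : E) (r i)}
      isOpen_baseSet := fun i => Metric.isOpen_ball.preimage continuous_subtype_val
      indexAt := id
      mem_baseSet_at := fun x => Metric.mem_ball_self (hr x)
      coordChange := fun i j x c => mk (c.1 + (g i x - g j x))
      coordChange_self := fun i x hx v => by simp [mk]
      continuousOn_coordChange := fun i j => by
        rintro ⟨x, c⟩ ⟨hx, -⟩
        apply ContinuousWithinAt.congr_of_eventuallyEq
          (f := fun p : U × D => mk (p.2.1 + (g i x - g j x)))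
        · exact (continuous_of_discreteTopology (f := fun d : D => mk (d.1 + (g i x - g j x)))
            |>.comp continuous_snd).continuousWithinAt
        · filter_upwards [self_mem_nhdsWithin] with p hp
          rw [hconst i j p.1 hp.1 x hx]
        · rfl
      coordChange_comp := fun i j k x hx v => by
        apply Subtype.ext
        simp only [mk]
        abel }
  have hcov : IsCoveringMap (Bundle.TotalSpace.proj : Z.TotalSpace → U) :=
    FiberBundle.isCoveringMap (F := D) (E := Z.Fiber)
  obtain ⟨x₀, hx₀⟩ := hUc.nonempty
  -- Lifting the identity of `U` gives a global section, that is, a coherent choice of local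
  -- primitives.
  obtain ⟨s, ⟨-, hs⟩, -⟩ := hcov.existsUnique_continuousMap_lifts (ContinuousMap.id U) ⟨x₀, hx₀⟩
    (⟨⟨x₀, hx₀⟩, mk 0⟩ : Z.TotalSpace) rfl
  have hs' : ∀ x, (s x).1 = x := fun x => congrFun hs x
  /- the value of the section `s` over `x`, read in the chart of index `i` -/
  let val : U → U → D := fun i x => (Z.localTriv i (s x)).2
  have hval : ∀ i x : U, (x : E) ∈ Metric.ball (i : E) (r i) →
      (val x x).1 + g x x = (val i x).1 + g i x := by
    intro i x hx
    have h1 : ∀ k, val k x = mk ((s x).2.1 + (g (s x).1 (s x).1 - g k (s x).1)) := fun k => rfl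
    rw [h1, h1, hs' x]
    simp only [mk]
    abel
  have hcont : ∀ i : U, ∀ᶠ x in nhds i, val i x = val i i := by
    intro i
    have hc : ContinuousAt (fun x => Z.localTriv i (s x)) i := by
      apply ContinuousAt.comp (g := Z.localTriv i) _ s.continuous.continuousAt
      apply (Z.localTriv i).continuousAt
      rw [Bundle.Trivialization.mem_source]
      change ((s i).1 : E) ∈ Metric.ball (i : E) (r i)
      rw [hs' i]
      exact Metric.mem_ball_self (hr i)
    have h2 : ContinuousAt (val i) i := continuous_snd.continuousAt.comp hc
    exact h2.eventually (p := fun d => d = val i i)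
      (by rw [nhds_discrete]; exact Filter.mem_pure.2 rfl)
  refine ⟨fun x => if hx : x ∈ U then (val ⟨x, hx⟩ ⟨x, hx⟩).1 + g ⟨x, hx⟩ x else 0, ?_⟩
  intro a ha
  have hev : ∀ᶠ x in nhds a, ∀ hx : x ∈ U, val ⟨a, ha⟩ ⟨x, hx⟩ = val ⟨a, ha⟩ ⟨a, ha⟩ := by
    have := hcont ⟨a, ha⟩
    rw [nhds_subtype_eq_comap] at this
    obtain ⟨S, hS, hSs⟩ := Filter.mem_comap.1 this
    filter_upwards [hS] with x hx hxU
    exact hSs (a := ⟨x, hxU⟩) hx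
  apply ((hg ⟨a, ha⟩ a (Metric.mem_ball_self (hr _))).const_add
    (val ⟨a, ha⟩ ⟨a, ha⟩).1).congr_of_eventuallyEq
  filter_upwards [hev, hUo.mem_nhds ha, Metric.ball_mem_nhds a (hr ⟨a, ha⟩)] with x h1 hxU hxb
  simp only [hxU, dif_pos]
  rw [hval ⟨a, ha⟩ ⟨x, hxU⟩ hxb, h1 hxU]

/-! ### Holomorphic functions of several variables. -/

open Metric in
/-- **Cauchy estimate** for the Fréchet derivative. -/
theorem norm_fderiv_le_div_of_closedBall {E F : Type*} [NormedAddCommGroup E] [NormedSpace ℂ E]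
    [NormedAddCommGroup F] [NormedSpace ℂ F] {f : E → F} {x : E} {ρ C : ℝ} (hρ : 0 < ρ)
    (hd : ∀ y ∈ closedBall x ρ, DifferentiableAt ℂ f y) (hC : ∀ y ∈ closedBall x ρ, ‖f y‖ ≤ C) :
    ‖fderiv ℂ f x‖ ≤ C / ρ := by
  have hx : x ∈ closedBall x ρ := mem_closedBall_self hρ.le
  have hC0 : 0 ≤ C := (norm_nonneg _).trans (hC x hx)
  refine ContinuousLinearMap.opNorm_le_bound _ (by positivity) fun h => ?_
  rcases eq_or_ne h 0 with rfl | hh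
  · simp
  have hh' : 0 < ‖h‖ := norm_pos_iff.2 hh
  have hmem : ∀ ζ ∈ closedBall (0 : ℂ) (ρ / ‖h‖), x + ζ • h ∈ closedBall x ρ := by
    intro ζ hζ
    rw [mem_closedBall_zero_iff, le_div_iff₀ hh'] at hζ
    simpa [norm_smul] using hζ
  have hline : ∀ ζ : ℂ, HasDerivAt (fun ζ : ℂ => x + ζ • h) h ζ := fun ζ => by
    simpa using ((hasDerivAt_id ζ).smul_const h).const_add x
  have hφ : HasDerivAt (fun ζ : ℂ => f (x + ζ • h)) (fderiv ℂ f x h) 0 := by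
    have h1 : HasFDerivAt f (fderiv ℂ f x) (x + (0 : ℂ) • h) := by
      simpa using (hd x hx).hasFDerivAt
    exact h1.comp_hasDerivAt (0 : ℂ) (hline 0)
  have := Complex.norm_deriv_le_of_forall_mem_sphere_norm_le (c := 0) (R := ρ / ‖h‖) (C := C)
    (f := fun ζ : ℂ => f (x + ζ • h)) (by positivity)
    (DifferentiableOn.diffContOnCl_ball (U := closedBall 0 (ρ / ‖h‖)) (fun ζ hζ =>
      ((hd _ (hmem ζ hζ)).comp ζ (hline ζ).differentiableAt).differentiableWithinAt) subset_rfl)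
    (fun ζ hζ => hC _ (hmem ζ (sphere_subset_closedBall hζ)))
  rw [hφ.deriv] at this
  calc _ ≤ _ := this
    _ = C / ρ * ‖h‖ := by field_simp

open Metric MeasureTheory in
/-- Directional derivatives of holomorphic functions of several variables are holomorphic. -/
theorem DifferentiableOn.fderiv_apply_complex {E F : Type*} [NormedAddCommGroup E]
    [NormedSpace ℂ E] [FiniteDimensional ℂ E] [NormedAddCommGroup F] [NormedSpace ℂ F]
    [FiniteDimensional ℂ F] {f : E → F} {U : Set E} (hU : IsOpen U)
    (hf : DifferentiableOn ℂ f U) (h : E) :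
    DifferentiableOn ℂ (fun x => fderiv ℂ f x h) U := by
  have : ProperSpace E := FiniteDimensional.proper ℂ E
  have : ProperSpace F := FiniteDimensional.proper ℂ F
  have : ProperSpace (E →L[ℂ] F) := FiniteDimensional.proper ℂ _
  have : CompleteSpace F := FiniteDimensional.complete ℂ F
  let _ : MeasurableSpace E := borel E
  have : BorelSpace E := ⟨rfl⟩
  let _ : MeasurableSpace F := borel F
  have : BorelSpace F := ⟨rfl⟩
  intro x₀ hx₀
  have hat : ∀ y ∈ U, DifferentiableAt ℂ f y := fun y hy => hf.differentiableAt (hU.mem_nhds hy)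
  obtain ⟨R, hR, hRs⟩ : ∃ R > 0, ball x₀ R ⊆ U ∩ {y | ‖f y‖ < ‖f x₀‖ + 1} := by
    refine Metric.mem_nhds_iff.1 (Filter.inter_mem (hU.mem_nhds hx₀) ?_)
    exact (hat x₀ hx₀).continuousAt.norm.eventually (gt_mem_nhds (lt_add_one _))
  set K := ‖f x₀‖ + 1
  -- Room for a point within `ρ` of `x₀`, a shift by less than `ρ`, and a Cauchy ball of radius `ρ`.
  obtain ⟨ρ, hρ, hρR⟩ : ∃ ρ > 0, 4 * ρ = R := ⟨R / 4, by positivity, by ring⟩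
  have hbd : ∀ y ∈ ball x₀ (2 * ρ), ‖fderiv ℂ f y‖ ≤ K / ρ := by
    intro y hy
    have hsub : closedBall y ρ ⊆ ball x₀ R := closedBall_subset_ball' (by
      have := mem_ball.1 hy; linarith)
    exact norm_fderiv_le_div_of_closedBall hρ (fun z hz => hat z (hRs (hsub hz)).1)
      fun z hz => (hRs (hsub hz)).2.le
  obtain ⟨t, ht, hth⟩ : ∃ t > 0, t * ‖h‖ < ρ :=
    ⟨ρ / (‖h‖ + 1), by positivity, by rw [div_mul_eq_mul_div, div_lt_iff₀ (by positivity)]; nlinarith⟩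
  have hmem : ∀ x ∈ ball x₀ ρ, ∀ ζ ∈ closedBall (0 : ℂ) t, x + ζ • h ∈ ball x₀ (2 * ρ) := by
    intro x hx ζ hζ
    rw [mem_ball, dist_eq_norm] at hx ⊢
    rw [mem_closedBall_zero_iff] at hζ
    calc ‖x + ζ • h - x₀‖ = ‖(x - x₀) + ζ • h‖ := by congr 1; abel
      _ ≤ ‖x - x₀‖ + ‖ζ‖ * ‖h‖ := (norm_add_le _ _).trans (by rw [norm_smul])
      _ ≤ ‖x - x₀‖ + t * ‖h‖ := by gcongr
      _ < 2 * ρ := by linarith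
  have hball : ball x₀ (2 * ρ) ⊆ U := fun y hy =>
    (hRs (ball_subset_ball (by linarith) hy)).1
  have hcirc : ∀ θ : ℝ, circleMap 0 t θ ∈ closedBall (0 : ℂ) t := fun θ =>
    circleMap_mem_closedBall 0 ht.le θ
  -- The kernel of Cauchy's formula for the first derivative; the plan is to differentiate that
  -- integral in `x`.
  let c : ℝ → ℂ := fun θ => _root_.deriv (circleMap 0 t) θ * (1 / (circleMap 0 t θ - 0) ^ 2)
  have hc : Continuous c := by
    simp only [c, deriv_circleMap]
    refine Continuous.mul (by fun_prop) (Continuous.div continuous_const (by fun_prop) fun θ => ?_)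
    rw [sub_zero]
    exact pow_ne_zero _ (circleMap_ne_center ht.ne')
  have hline : ∀ x : E, ∀ ζ : ℂ, HasDerivAt (fun ζ : ℂ => x + ζ • h) h ζ := fun x ζ => by
    simpa using ((hasDerivAt_id ζ).smul_const h).const_add x
  have hcauchy : ∀ x ∈ ball x₀ ρ, fderiv ℂ f x h = (2 * Real.pi * Complex.I : ℂ)⁻¹ •
      ∫ θ in (0 : ℝ)..2 * Real.pi, c θ • f (x + circleMap 0 t θ • h) := by
    intro x hx
    have hφ : HasDerivAt (fun ζ : ℂ => f (x + ζ • h)) (fderiv ℂ f x h) 0 := by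
      have h1 : HasFDerivAt f (fderiv ℂ f x) (x + (0 : ℂ) • h) := by
        simpa using (hat x (hball (ball_subset_ball (by linarith) hx))).hasFDerivAt
      exact h1.comp_hasDerivAt (0 : ℂ) (hline x 0)
    have h2 := DifferentiableOn.deriv_eq_smul_circleIntegral (c := 0)
      (f := fun ζ : ℂ => f (x + ζ • h)) ht (fun ζ hζ =>
      ((hat _ (hball (hmem x hx ζ hζ))).comp ζ (hline x ζ).differentiableAt).differentiableWithinAt)
    rw [hφ.deriv] at h2
    rw [eq_inv_smul_iff₀ Complex.two_pi_I_ne_zero, ← h2, circleIntegral]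
    simp only [c, mul_smul]
  have hcontF : ∀ x ∈ ball x₀ ρ, Continuous fun θ : ℝ => c θ • f (x + circleMap 0 t θ • h) := by
    intro x hx
    refine hc.smul ?_
    have : Continuous fun θ : ℝ => x + circleMap 0 t θ • h := by fun_prop
    exact hf.continuousOn.comp_continuous this fun θ => hball (hmem x hx _ (hcirc θ))
  have key := intervalIntegral.hasFDerivAt_integral_of_dominated_of_fderiv_le (𝕜 := ℂ)
    (μ := volume) (a := 0) (b := 2 * Real.pi) (s := ball x₀ ρ) (x₀ := x₀)
    (F := fun x θ => c θ • f (x + circleMap 0 t θ • h))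
    (F' := fun x θ => c θ • fderiv ℂ f (x + circleMap 0 t θ • h))
    (bound := fun θ => ‖c θ‖ * (K / ρ)) (ball_mem_nhds x₀ hρ)
    (by
      filter_upwards [ball_mem_nhds x₀ hρ] with x hx
      exact (hcontF x hx).aestronglyMeasurable)
    ((hcontF x₀ (mem_ball_self hρ)).intervalIntegrable _ _)
    (by
      have h1 : Measurable fun θ : ℝ => fderiv ℂ f (x₀ + circleMap 0 t θ • h) :=
        (measurable_fderiv ℂ f).comp (by
          have : Continuous fun θ : ℝ => x₀ + circleMap 0 t θ • h := by fun_prop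
          exact this.measurable)
      exact hc.aestronglyMeasurable.smul h1.aestronglyMeasurable)
    (by
      refine Filter.Eventually.of_forall fun θ _ x hx => ?_
      rw [norm_smul]
      gcongr
      exact hbd _ (hmem x hx _ (hcirc θ)))
    ((hc.norm.mul continuous_const).intervalIntegrable _ _)
    (by
      refine Filter.Eventually.of_forall fun θ _ x hx => ?_
      have h1 := (hat _ (hball (hmem x hx _ (hcirc θ)))).hasFDerivAt
      have h2 := h1.comp x ((hasFDerivAt_id x).add_const (circleMap 0 t θ • h))
      exact h2.const_smul (c θ))
  have := (key.differentiableAt.const_smul (2 * Real.pi * Complex.I : ℂ)⁻¹)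
  refine (this.congr_of_eventuallyEq ?_).differentiableWithinAt
  filter_upwards [ball_mem_nhds x₀ hρ] with x hx
  exact hcauchy x hx

/-- Holomorphic functions of several variables are smooth. -/
theorem DifferentiableOn.contDiffOn_complex {E F : Type*} [NormedAddCommGroup E]
    [NormedSpace ℂ E] [FiniteDimensional ℂ E] [NormedAddCommGroup F] [NormedSpace ℂ F]
    [FiniteDimensional ℂ F] {U : Set E} (hU : IsOpen U) (n : ℕ) :
    ∀ {f : E → F}, DifferentiableOn ℂ f U → ContDiffOn ℂ n f U := by
  induction n with
  | zero => exact fun hf => contDiffOn_zero.2 hf.continuousOn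
  | succ n ih =>
    intro f hf
    push_cast
    rw [contDiffOn_succ_iff_fderiv_of_isOpen hU]
    refine ⟨hf, fun h => by simp at h, contDiffOn_clm_apply.2 fun h => ?_⟩
    exact ih (hf.fderiv_apply_complex hU h)

open Metric in
/-- Iterated Cauchy estimates. -/
theorem norm_iteratedFDeriv_le_of_closedBall {E F : Type*} [NormedAddCommGroup E] [NormedSpace ℂ E]
    [NormedAddCommGroup F] [NormedSpace ℂ F] {f : E → F} {U : Set E} (hU : IsOpen U)
    (hf : ∀ n : ℕ, ContDiffOn ℂ n f U) {K δ : ℝ} (hδ : 0 < δ) (hK : ∀ y ∈ U, ‖f y‖ ≤ K) (n : ℕ) :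
    ∀ x, closedBall x (n * δ) ⊆ U → ‖iteratedFDeriv ℂ n f x‖ ≤ K / δ ^ n := by
  induction n with
  | zero =>
    intro x hx
    simpa using hK x (hx (by simp))
  | succ n ih =>
    intro x hx
    have hsub : ∀ y ∈ closedBall x δ, closedBall y (n * δ) ⊆ U := fun y hy =>
      (closedBall_subset_closedBall' (by
        have := mem_closedBall.1 hy
        push_cast
        linarith)).trans hx
    rw [← norm_fderiv_iteratedFDeriv, pow_succ, ← div_div]
    refine norm_fderiv_le_div_of_closedBall hδ (fun y hy => ?_) fun y hy => ih y (hsub y hy)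
    have hy : y ∈ U := hsub y hy (mem_closedBall_self (by positivity))
    exact ((hf (n + 1)).contDiffAt (hU.mem_nhds hy)).differentiableAt_iteratedFDeriv
      (by exact_mod_cast Nat.lt_succ_self n)

open Metric in
/-- The Taylor expansion along complex lines. -/
theorem hasSum_iteratedFDeriv_of_ball {E F : Type*} [NormedAddCommGroup E] [NormedSpace ℂ E]
    [NormedAddCommGroup F] [NormedSpace ℂ F] [CompleteSpace F] {f : E → F} {x : E} {R : ℝ}
    (hf : ∀ n : ℕ, ContDiffOn ℂ n f (ball x R)) {y : E} (hy : ‖y‖ < R) :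
    HasSum (fun n : ℕ => (n.factorial : ℂ)⁻¹ • iteratedFDeriv ℂ n f x fun _ => y) (f (x + y)) := by
  let g : ℂ →L[ℂ] E := ContinuousLinearMap.toSpanSingleton ℂ y
  let φ : E → F := fun z => f (x + z)
  have hR : 0 < R := (norm_nonneg y).trans_lt hy
  have hφ : ∀ n : ℕ, ContDiffOn ℂ n φ (ball 0 R) := by
    intro n
    refine (hf n).comp (contDiff_const.add contDiff_id).contDiffOn fun z hz => ?_
    simpa using hz
  have hV : IsOpen (g ⁻¹' ball 0 R) := isOpen_ball.preimage g.continuous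
  -- The one-variable Taylor series along `ζ ↦ x + ζ • y` is evaluated at `1`, so its disc must have
  -- radius above `1`.
  obtain ⟨q, hq, hqs⟩ : ∃ q > 1, ball (0 : ℂ) q ⊆ g ⁻¹' ball 0 R := by
    rcases eq_or_ne y 0 with rfl | hy0
    · exact ⟨2, by norm_num, fun z _ => by simpa [g] using hR⟩
    · have hy0 := norm_pos_iff.2 hy0
      refine ⟨R / ‖y‖, (one_lt_div hy0).2 hy, fun z hz => ?_⟩
      rw [mem_ball_zero_iff, lt_div_iff₀ hy0] at hz
      simpa [g, norm_smul] using hz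
  have hd : DifferentiableOn ℂ (φ ∘ g) (ball 0 q) := by
    refine DifferentiableOn.mono ?_ hqs
    exact ((hφ 1).differentiableOn (by simp)).comp g.differentiable.differentiableOn
      (Set.mapsTo_preimage _ _)
  have := Complex.hasSum_taylorSeries_on_ball hd (z := 1) (by simpa using hq)
  have hval : (φ ∘ g) 1 = f (x + y) := by simp [φ, g]
  rw [hval] at this
  convert this using 2 with n
  rw [sub_zero, one_pow, one_smul, iteratedDeriv_eq_iteratedFDeriv]
  have h0 : (0 : ℂ) ∈ g ⁻¹' ball 0 R := by simpa using hR
  have h1 := g.iteratedFDerivWithin_comp_right (hφ n) isOpen_ball.uniqueDiffOn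
    hV.uniqueDiffOn (x := 0) (by simpa using hR) le_rfl
  rw [iteratedFDerivWithin_of_isOpen n hV h0,
    iteratedFDerivWithin_of_isOpen n isOpen_ball h0] at h1
  rw [h1, ContinuousMultilinearMap.compContinuousLinearMap_apply]
  simp [φ, g, iteratedFDeriv_comp_add_left]

open Metric in
/-- **Osgood's lemma**: holomorphic functions of several variables are analytic. -/
theorem DifferentiableOn.analyticOnNhd_of_finiteDimensional {E F : Type*} [NormedAddCommGroup E]
    [NormedSpace ℂ E] [FiniteDimensional ℂ E] [NormedAddCommGroup F] [NormedSpace ℂ F]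
    [FiniteDimensional ℂ F] {f : E → F} {U : Set E} (hU : IsOpen U)
    (hf : DifferentiableOn ℂ f U) : AnalyticOnNhd ℂ f U := by
  have : CompleteSpace F := FiniteDimensional.complete ℂ F
  intro x₀ hx₀
  obtain ⟨R, hR, hRs⟩ : ∃ R > 0, ball x₀ R ⊆ U ∩ {y | ‖f y‖ < ‖f x₀‖ + 1} := by
    refine Metric.mem_nhds_iff.1 (Filter.inter_mem (hU.mem_nhds hx₀) ?_)
    exact (hf.differentiableAt (hU.mem_nhds hx₀)).continuousAt.norm.eventually
      (gt_mem_nhds (lt_add_one _))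
  set K := ‖f x₀‖ + 1
  have hK0 : 0 ≤ K := by positivity
  have hsm : ∀ n : ℕ, ContDiffOn ℂ n f (ball x₀ R) := fun n =>
    DifferentiableOn.contDiffOn_complex isOpen_ball n (hf.mono fun y hy => (hRs hy).1)
  let p : FormalMultilinearSeries ℂ E F := fun n => (n.factorial : ℂ)⁻¹ • iteratedFDeriv ℂ n f x₀
  have hp : ∀ n, ‖p n‖ ≤ K * Real.exp 1 * (2 * Real.exp 1 / R) ^ n := by
    intro n
    -- Steps of order `R / n` let `n` Cauchy estimates fit in the ball and cost about `n ^ n`, which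
    -- `n!` absorbs up to a geometric factor.
    have hδ : 0 < R / (2 * (n + 1)) := by positivity
    have h1 := norm_iteratedFDeriv_le_of_closedBall isOpen_ball hsm hδ
      (fun y hy => (hRs hy).2.le) n x₀ (closedBall_subset_ball (by
        rw [← mul_div_assoc, div_lt_iff₀ (by positivity)]
        nlinarith))
    have h2 := Real.pow_div_factorial_le_exp (x := (n + 1 : ℝ)) (by positivity) (n + 1)
    have h3 : ((n : ℝ) + 1) ^ n / n.factorial ≤ Real.exp 1 ^ (n + 1) := by
      rw [← Real.exp_nat_mul, mul_one]
      push_cast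
      refine le_trans (le_of_eq ?_) h2
      rw [Nat.factorial_succ, pow_succ]
      push_cast
      field_simp
    simp only [p]
    rw [norm_smul, norm_inv, Complex.norm_natCast]
    calc (n.factorial : ℝ)⁻¹ * ‖iteratedFDeriv ℂ n f x₀‖
        ≤ (n.factorial : ℝ)⁻¹ * (K / (R / (2 * (n + 1))) ^ n) := by gcongr
      _ = K * (2 / R) ^ n * (((n : ℝ) + 1) ^ n / n.factorial) := by
        simp only [div_pow, mul_pow]
        field_simp
      _ ≤ K * (2 / R) ^ n * Real.exp 1 ^ (n + 1) := by gcongr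
      _ = _ := by
        simp only [div_pow, mul_pow, pow_succ]
        ring
  let r : NNReal := ⟨R / (2 * Real.exp 1), by positivity⟩
  have hr : 0 < r := by
    rw [← NNReal.coe_pos]
    change 0 < R / (2 * Real.exp 1)
    positivity
  have hrR : (r : ℝ) ≤ R := by
    change R / (2 * Real.exp 1) ≤ R
    apply div_le_self hR.le
    have := Real.add_one_le_exp 1
    linarith
  refine ⟨p, r, ?_, ENNReal.coe_pos.2 hr, fun {y} hy => ?_⟩
  · refine p.le_radius_of_bound (K * Real.exp 1) fun n => ?_
    calc ‖p n‖ * (r : ℝ) ^ n ≤ K * Real.exp 1 * (2 * Real.exp 1 / R) ^ n * (r : ℝ) ^ n := by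
          gcongr
          exact hp n
      _ = K * Real.exp 1 * (2 * Real.exp 1 / R * (R / (2 * Real.exp 1))) ^ n := by
          rw [mul_assoc, ← mul_pow]; rfl
      _ = K * Real.exp 1 := by
          rw [show 2 * Real.exp 1 / R * (R / (2 * Real.exp 1)) = 1 by field_simp, one_pow, mul_one]
  · have hy' : ‖y‖ < R := by
      rw [Metric.eball_coe, mem_ball_zero_iff] at hy
      exact hy.trans_le hrR
    exact hasSum_iteratedFDeriv_of_ball hsm hy'

/-! ### From complex structures to real analyticity. -/

/-- A real vector space with an endomorphism of square `-1` has complex coordinates. -/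
theorem exists_linearEquiv_complex {E : Type*} [AddCommGroup E] [Module ℝ E]
    [FiniteDimensional ℝ E] (J : E →ₗ[ℝ] E) (hJ : J ∘ₗ J = -LinearMap.id) :
    ∃ (m : ℕ) (e : (Fin m → ℂ) ≃ₗ[ℝ] E), ∀ z, e (Complex.I • z) = J (e z) := by
  let ρ : ℂ →ₐ[ℝ] Module.End ℝ E := Complex.lift ⟨J, hJ⟩
  let _ : Module ℂ E := Module.compHom E ρ.toRingHom
  have hsmul : ∀ (c : ℂ) (x : E), c • x = ρ c x := fun c x => rfl
  have : IsScalarTower ℝ ℂ E := ⟨fun r c x => by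
    rw [hsmul, hsmul, map_smul]; rfl⟩
  have : FiniteDimensional ℂ E := FiniteDimensional.right ℝ ℂ E
  let e := (Module.finBasis ℂ E).equivFun.symm
  refine ⟨_, e.restrictScalars ℝ, fun z => ?_⟩
  rw [LinearEquiv.restrictScalars_apply, map_smul, hsmul]
  simp [ρ]

/-- A differentiable map between real spaces whose derivative intertwines complex structures is
real-analytic. -/
theorem DifferentiableOn.analyticOnNhd_of_complexStructure {E F : Type*} [NormedAddCommGroup E]
    [NormedSpace ℝ E] [FiniteDimensional ℝ E] [NormedAddCommGroup F] [NormedSpace ℝ F]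
    [FiniteDimensional ℝ F] {f : E → F} {U : Set E} (hU : IsOpen U)
    (hf : DifferentiableOn ℝ f U) (J : E →ₗ[ℝ] E) (hJ : J ∘ₗ J = -LinearMap.id)
    (J' : F →ₗ[ℝ] F) (hJ' : J' ∘ₗ J' = -LinearMap.id)
    (hcomm : ∀ b ∈ U, ∀ x, fderiv ℝ f b (J x) = J' (fderiv ℝ f b x)) :
    AnalyticOnNhd ℝ f U := by
  obtain ⟨m, e, he⟩ := exists_linearEquiv_complex J hJ
  obtain ⟨m', e', he'⟩ := exists_linearEquiv_complex J' hJ'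
  let E₁ := e.toContinuousLinearEquiv
  let E₂ := e'.toContinuousLinearEquiv
  let g : (Fin m → ℂ) → (Fin m' → ℂ) := fun z => E₂.symm (f (E₁ z))
  have hV : IsOpen (E₁ ⁻¹' U) := hU.preimage E₁.continuous
  have hg : DifferentiableOn ℂ g (E₁ ⁻¹' U) := by
    intro z hz
    have h1 : HasFDerivAt g ((E₂.symm : F →L[ℝ] (Fin m' → ℂ)) ∘L (fderiv ℝ f (E₁ z)) ∘L
        (E₁ : (Fin m → ℂ) →L[ℝ] E)) z :=
      (E₂.symm : F →L[ℝ] (Fin m' → ℂ)).hasFDerivAt.comp z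
        (((hf.differentiableAt (hU.mem_nhds hz)).hasFDerivAt).comp z (E₁ : (Fin m → ℂ) →L[ℝ] E).hasFDerivAt)
    set L := (E₂.symm : F →L[ℝ] (Fin m' → ℂ)) ∘L (fderiv ℝ f (E₁ z)) ∘L (E₁ : (Fin m → ℂ) →L[ℝ] E) with hL
    -- The Cauchy–Riemann equations in the complex coordinates.
    have hI : ∀ v, L (Complex.I • v) = Complex.I • L v := by
      intro v
      apply E₂.injective
      have h2 : E₂ (L (Complex.I • v)) = fderiv ℝ f (E₁ z) (E₁ (Complex.I • v)) := by simp [hL]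
      have h3 : E₂ (Complex.I • L v) = J' (fderiv ℝ f (E₁ z) (E₁ v)) := by
        rw [show E₂ (Complex.I • L v) = J' (E₂ (L v)) from he' _]
        simp [hL]
      rw [h2, h3, show E₁ (Complex.I • v) = J (E₁ v) from he v, hcomm _ hz]
    let LC : (Fin m → ℂ) →L[ℂ] (Fin m' → ℂ) :=
      { toFun := L
        map_add' := L.map_add
        map_smul' := fun c v => by
          have : c • v = c.re • v + c.im • Complex.I • v := by
            conv_lhs => rw [← Complex.re_add_im c, add_smul, mul_smul]
            rfl
          rw [this, map_add, map_smul, map_smul, hI]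
          conv_rhs => rw [← Complex.re_add_im c]
          rw [RingHom.id_apply, add_smul, mul_smul]
          rfl
        cont := L.continuous }
    have h2 : HasFDerivAt g LC z := by
      refine hasFDerivAt_of_restrictScalars ℝ h1 ?_
      ext v
      rfl
    exact h2.differentiableAt.differentiableWithinAt
  have han := (hg.analyticOnNhd_of_finiteDimensional hV)
  intro b hb
  have h1 : AnalyticAt ℝ g (E₁.symm b) := (han _ (by simpa using hb)).restrictScalars
  have h2 : f = fun b => E₂ (g (E₁.symm b)) := by
    ext b; simp [g]
  rw [h2]
  exact (E₂ : (Fin m' → ℂ) →L[ℝ] F).analyticAt _ |>.comp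
    (h1.comp (ContinuousLinearMap.analyticAt (E₁.symm : E →L[ℝ] (Fin m → ℂ)) b))

/-! ### Functions with `A`-linear derivative. -/

section AAnalytic

variable {A B : Type*} [NormedRing A] [NormedAlgebra ℝ A] [FiniteDimensional ℝ A]
  [NormedAddCommGroup B] [NormedSpace ℝ B] [FiniteDimensional ℝ B] [Module A B]
  [IsScalarTower ℝ A B]

/-- Iterated derivatives of a function with `A`-linear derivative are `A`-multilinear. -/
theorem iteratedFDeriv_update_smul_of_fderiv_smul {f : B → A} {U : Set B} (hU : IsOpen U)
    (hf : AnalyticOnNhd ℝ f U) (hlin : ∀ b ∈ U, ∀ (a : A) (x : B),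
      fderiv ℝ f b (a • x) = a * fderiv ℝ f b x) {b : B} (hb : b ∈ U) {k : ℕ} [DecidableEq (Fin k)]
    (m : Fin k → B) (j : Fin k) (a : A) (x : B) :
    iteratedFDeriv ℝ k f b (Function.update m j (a • x)) =
      a * iteratedFDeriv ℝ k f b (Function.update m j x) := by
  have : CompleteSpace A := FiniteDimensional.complete ℝ A
  cases k with
  | zero => exact j.elim0
  | succ k =>
  have hsm : ContDiffAt ℝ ⊤ f b := (hf b hb).contDiffAt
  let sB : B →L[ℝ] B := LinearMap.toContinuousLinearMap
    { toFun := fun y => a • y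
      map_add' := smul_add a
      map_smul' := fun r y => smul_comm a r y }
  let Φ₁ : (B →L[ℝ] A) →L[ℝ] (B →L[ℝ] A) := (ContinuousLinearMap.compL ℝ B B A).flip sB
  let Φ₂ : (B →L[ℝ] A) →L[ℝ] (B →L[ℝ] A) :=
    ContinuousLinearMap.compL ℝ B A A (ContinuousLinearMap.mul ℝ A a)
  -- In the last slot, `A`-linearity comes from differentiating the identity `Df (a • y) = a * Df y`
  -- in the base point; symmetry carries it to the other slots.
  have hlast : ∀ (p : Fin k → B) (y : B), iteratedFDeriv ℝ (k + 1) f b (Fin.snoc p (a • y)) =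
      a * iteratedFDeriv ℝ (k + 1) f b (Fin.snoc p y) := by
    intro p y
    have hd : ContDiffAt ℝ k (fderiv ℝ f) b := hsm.fderiv_right le_top
    have heq : (Φ₁ ∘ fderiv ℝ f) =ᶠ[nhds b] (Φ₂ ∘ fderiv ℝ f) := by
      filter_upwards [hU.mem_nhds hb] with c hc
      ext y
      exact hlin c hc a y
    have h1 := (heq.iteratedFDeriv ℝ k).eq_of_nhds
    rw [Φ₁.iteratedFDeriv_comp_left hd le_rfl, Φ₂.iteratedFDeriv_comp_left hd le_rfl] at h1
    have h2 := congrArg (fun L => L p y) h1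
    rw [iteratedFDeriv_succ_apply_right, iteratedFDeriv_succ_apply_right]
    simpa [Φ₁, Φ₂, sB] using h2
  have hperm : ∀ z : B, iteratedFDeriv ℝ (k + 1) f b (Function.update m j z) =
      iteratedFDeriv ℝ (k + 1) f b
        (Fin.snoc (fun i : Fin k => m (Equiv.swap j (Fin.last k) i.castSucc)) z) := by
    intro z
    rw [← hsm.iteratedFDeriv_comp_perm _ (Equiv.swap j (Fin.last k))]
    congr 1
    funext i
    refine Fin.lastCases ?_ (fun i => ?_) i
    · simp
    · rw [Fin.snoc_castSucc, Function.comp_apply, Function.update_of_ne]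
      rw [Ne, Equiv.swap_apply_eq_iff, Equiv.swap_apply_left]
      exact (Fin.castSucc_lt_last i).ne
  rw [hperm, hperm, hlast]

open Metric in
/-- Real-analytic functions with `A`-linear derivative are `A`-analytic. -/
theorem AnalyticOnNhd.isAAnalyticOn {f : B → A} {U : Set B} (hU : IsOpen U)
    (hf : AnalyticOnNhd ℝ f U) (hlin : ∀ b ∈ U, ∀ (a : A) (x : B),
      fderiv ℝ f b (a • x) = a * fderiv ℝ f b x) : IsAAnalyticOn f U := by
  have : CompleteSpace A := FiniteDimensional.complete ℝ A
  intro b₀ hb₀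
  obtain ⟨p, r, hp⟩ := hf b₀ hb₀
  refine ⟨eball b₀ r ∩ U, isOpen_eball.inter hU, ⟨mem_eball_self hp.r_pos, hb₀⟩,
    Set.inter_subset_right, fun i =>
    { toFun := fun m => (i.factorial : ℝ)⁻¹ • iteratedFDeriv ℝ i f b₀ m
      map_update_add' := fun m j x y => by
        rw [ContinuousMultilinearMap.map_update_add, smul_add]
      map_update_smul' := fun m j a x => by
        rw [iteratedFDeriv_update_smul_of_fderiv_smul hU hf hlin hb₀, smul_eq_mul,
          mul_smul_comm] }, ?_, ?_⟩
  · intro i σ x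
    have h : ContDiffAt ℝ ⊤ f b₀ := (hf b₀ hb₀).contDiffAt
    exact congrArg ((i.factorial : ℝ)⁻¹ • ·) (h.iteratedFDeriv_comp_perm x σ)
  · intro b hb
    have h := hp.hasSum_iteratedFDeriv (y := b - b₀) (by
      have := hb.1
      rw [mem_eball, edist_eq_enorm_sub] at this
      simpa using this)
    rw [add_sub_cancel] at h
    exact ⟨h.summable.norm, h⟩

/-- Let `A` be Frobenius with a square root of `-1`. A `C²` function with `A`-selfadjoint second
derivative on a simply connected open set is analytic and a component of an `A`-analytic
function. -/
theorem exists_isAAnalyticOn_of_fderiv_fderiv_smul (ψ : A →ₗ[ℝ] ℝ) (Φ : A ≃ₗ[ℝ] Module.Dual ℝ A)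
    (hΦ : ∀ a c, Φ a c = ψ (c * a)) (hψ : ∃ a, ψ a = 1) {J : A} (hJ : J * J = -1)
    {U : Set B} (hUo : IsOpen U) (hUc : IsSimplyConnected U) {v : B → ℝ}
    (hv : ContDiffOn ℝ 2 v U) (hsymm : ∀ b ∈ U, ∀ (a : A) (x y : B),
      fderiv ℝ (fderiv ℝ v) b y (a • x) = fderiv ℝ (fderiv ℝ v) b (a • y) x) :
    AnalyticOnNhd ℝ v U ∧ ∃ f : B → A, IsAAnalyticOn f U ∧ ∀ b ∈ U, v b = ψ (f b) := by
  have : CompleteSpace A := FiniteDimensional.complete ℝ A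
  let orbit : B →ₗ[ℝ] A →ₗ[ℝ] B := LinearMap.mk₂ ℝ (fun x c => c • x)
    (fun x y c => smul_add c x y) (fun r x c => smul_comm c r x)
    (fun x c d => add_smul c d x) (fun r x c => smul_assoc r c x)
  -- `Θ l x` represents the functional `c ↦ l (c • x)` through the Frobenius pairing.
  let Θ : (B →L[ℝ] ℝ) →L[ℝ] B →L[ℝ] A := LinearMap.toContinuousLinearMap
    ((LinearMap.toContinuousLinearMap : (B →ₗ[ℝ] A) ≃ₗ[ℝ] B →L[ℝ] A).toLinearMap ∘ₗ
      LinearMap.mk₂ ℝ (fun (l : B →L[ℝ] ℝ) x => Φ.symm (l.toLinearMap ∘ₗ orbit x))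
        (fun l l' x => by rw [← map_add]; rfl) (fun r l x => by rw [← map_smul]; rfl)
        (fun l x y => by rw [map_add, LinearMap.comp_add, map_add])
        (fun r l x => by rw [map_smul, LinearMap.comp_smul, map_smul]))
  have hΘ : ∀ l x c, ψ (c * Θ l x) = l (c • x) := fun l x c => by
    rw [← hΦ]
    change Φ (Φ.symm (l.toLinearMap ∘ₗ orbit x)) c = _
    rw [LinearEquiv.apply_symm_apply]
    rfl
  have hext : ∀ a a' : A, (∀ c, ψ (c * a) = ψ (c * a')) → a = a' := fun a a' h =>
    Φ.injective (LinearMap.ext fun c => by rw [hΦ, hΦ, h])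
  have hΘsmul : ∀ l (a : A) x, Θ l (a • x) = a * Θ l x := fun l a x =>
    hext _ _ fun c => by rw [hΘ, ← mul_assoc, hΘ, mul_smul]
  have hdv : ∀ b ∈ U, HasFDerivAt (fderiv ℝ v) (fderiv ℝ (fderiv ℝ v) b) b := fun b hb =>
    (((hv.contDiffAt (hUo.mem_nhds hb)).fderiv_right (m := 1) (by norm_num)).differentiableAt
      (by simp)).hasFDerivAt
  have hω : ∀ b ∈ U, HasFDerivAt (fun b => Θ (fderiv ℝ v b))
      (Θ ∘L fderiv ℝ (fderiv ℝ v) b) b := fun b hb => Θ.hasFDerivAt.comp b (hdv b hb)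
  obtain ⟨f, hf⟩ := hUc.exists_primitive hUo (ω := fun b => Θ (fderiv ℝ v b))
    (fun b hb => (hω b hb).differentiableAt.differentiableWithinAt) fun b hb x y => by
      rw [(hω b hb).fderiv]
      refine hext _ _ fun c => ?_
      have hs : IsSymmSndFDerivAt ℝ v b :=
        (hv.contDiffAt (hUo.mem_nhds hb)).isSymmSndFDerivAt (by simp)
      rw [ContinuousLinearMap.comp_apply, ContinuousLinearMap.comp_apply, hΘ, hΘ,
        hsymm b hb c y x]
      exact hs.eq _ _
  obtain ⟨e, he⟩ := hψ
  obtain ⟨b₀, hb₀⟩ := hUc.nonempty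
  -- The constant is chosen so that `ψ ∘ g` agrees with `v` at `b₀`.
  let g : B → A := fun b => f b + (v b₀ - ψ (f b₀)) • e
  have hg : ∀ b ∈ U, HasFDerivAt g (Θ (fderiv ℝ v b)) b := fun b hb => (hf b hb).add_const _
  have hglin : ∀ b ∈ U, ∀ (a : A) x, fderiv ℝ g b (a • x) = a * fderiv ℝ g b x :=
    fun b hb a x => by rw [(hg b hb).fderiv, hΘsmul]
  have hgan : AnalyticOnNhd ℝ g U := by
    refine DifferentiableOn.analyticOnNhd_of_complexStructure hUo
      (fun b hb => (hg b hb).differentiableAt.differentiableWithinAt)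
      (orbit.flip J) ?_ (LinearMap.mulLeft ℝ J) ?_ fun b hb x => hglin b hb J x
    · ext x
      change J • J • x = -x
      rw [← mul_smul, hJ, neg_smul, one_smul]
    · ext x
      change J * (J * x) = -x
      rw [← mul_assoc, hJ, neg_mul, one_mul]
  let ψc : A →L[ℝ] ℝ := LinearMap.toContinuousLinearMap ψ
  have hdiff : ∀ c ∈ U, HasFDerivAt (fun c => v c - ψ (g c)) (0 : B →L[ℝ] ℝ) c := by
    intro c hc
    have h1 : HasFDerivAt v (fderiv ℝ v c) c :=
      ((hv.contDiffAt (hUo.mem_nhds hc)).differentiableAt (by simp)).hasFDerivAt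
    have h2 : HasFDerivAt (fun c => ψ (g c)) (ψc ∘L Θ (fderiv ℝ v c)) c :=
      ψc.hasFDerivAt.comp c (hg c hc)
    have h3 : ψc ∘L Θ (fderiv ℝ v c) = fderiv ℝ v c := by
      ext x
      simpa [ψc] using hΘ (fderiv ℝ v c) x 1
    have := h1.sub (h3 ▸ h2)
    rwa [sub_self] at this
  have hvg : ∀ b ∈ U, v b = ψ (g b) := fun b hb => by
    have := hUo.is_const_of_fderiv_eq_zero hUc.isPathConnected.isConnected.isPreconnected
      (fun c hc => (hdiff c hc).differentiableAt.differentiableWithinAt)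
      (fun c hc => (hdiff c hc).fderiv) hb hb₀
    have h0 : v b₀ - ψ (g b₀) = 0 := by simp [g, he]
    linarith
  have hψg : AnalyticOnNhd ℝ (fun b => ψc (g b)) U := fun b hb =>
    (ψc.analyticAt _).comp (hgan b hb)
  exact ⟨hψg.congr hUo fun b hb => (hvg b hb).symm, g, hgan.isAAnalyticOn hUo hglin, hvg⟩

end AAnalytic

/-! ### The algebra generated by a matrix. -/

section Matrix

variable {n : ℕ}

attribute [local instance] Matrix.linftyOpNormedAlgebra

theorem MatAlg.smul_eq_mulVec {N : Matrix (Fin n) (Fin n) ℝ} (a : MatAlg N) (x : Fin n → ℝ) :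
    a • x = (a : Matrix (Fin n) (Fin n) ℝ) *ᵥ x := rfl

/-- The algebra generated by the transpose of a real matrix without real eigenvalues contains a
square root of `-1`. -/
theorem MatAlg.exists_mul_self_eq_neg_one {M : Matrix (Fin n) (Fin n) ℝ}
    (hM : ¬ ∃ μ : ℝ, Module.End.HasEigenvalue (Matrix.toLin' M) μ) :
    ∃ J : MatAlg Mᵀ, J * J = -1 := by
  obtain ⟨p, hp⟩ := exists_dvd_sq_add_one M.charpoly M.charpoly_monic.ne_zero fun μ hμ =>
    hM ⟨μ, by
      rw [Module.End.hasEigenvalue_iff_isRoot_charpoly, Matrix.charpoly_toLin']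
      exact hμ⟩
  refine ⟨⟨Polynomial.aeval Mᵀ p, Polynomial.aeval_mem_adjoin_singleton _ _⟩, Subtype.ext ?_⟩
  have h : Polynomial.aeval Mᵀ (p ^ 2 + 1) = 0 := by
    obtain ⟨q, hq⟩ := hp
    rw [hq, map_mul, ← Matrix.charpoly_transpose, Matrix.aeval_self_charpoly, zero_mul]
  rw [map_add, map_pow, map_one] at h
  rw [← sq]
  exact eq_neg_of_add_eq_zero_left h

/-- Selfadjointness of a bilinear map with respect to `N` extends to the algebra generated by
`N`. -/
theorem MatAlg.apply_smul_eq {N : Matrix (Fin n) (Fin n) ℝ}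
    (S : (Fin n → ℝ) →L[ℝ] (Fin n → ℝ) →L[ℝ] ℝ)
    (hS : ∀ x y, S y (N *ᵥ x) = S (N *ᵥ y) x) (a : MatAlg N) (x y : Fin n → ℝ) :
    S y (a • x) = S (a • y) x := by
  obtain ⟨a, ha⟩ := a
  simp only [MatAlg.smul_eq_mulVec]
  induction ha using Algebra.adjoin_induction generalizing x y with
  | mem a ha => rw [Set.mem_singleton_iff.1 ha, hS]
  | algebraMap r => simp [Algebra.algebraMap_eq_smul_one, Matrix.smul_mulVec]
  | add a b _ _ ha hb => simp only [Matrix.add_mulVec, map_add, add_apply, ha, hb]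
  | mul a b ha' hb' ha hb =>
    -- Carrying `a` and then `b` across `S` reverses their order, so commutativity is needed.
    have hab : Commute a b := Algebra.commute_of_mem_adjoin_singleton_of_commute hb'
      (Algebra.commute_of_mem_adjoin_singleton_of_commute ha' (Commute.refl N)).symm
    rw [← Matrix.mulVec_mulVec, ha, hb, Matrix.mulVec_mulVec, hab.eq]

/-- A `C²` function whose second derivative is selfadjoint with respect to a matrix without real
eigenvalues is analytic and a component of an `A`-analytic function. -/
theorem MatAlg.analyticOnNhd_and_isComponent (hn : 1 ≤ n) {M : Matrix (Fin n) (Fin n) ℝ}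
    (hM : ¬ ∃ μ : ℝ, Module.End.HasEigenvalue (Matrix.toLin' M) μ) {U : Set (Fin n → ℝ)}
    (hUo : IsOpen U) (hUc : IsSimplyConnected U) {v : (Fin n → ℝ) → ℝ} (hv : ContDiffOn ℝ 2 v U)
    (hS : ∀ b ∈ U, ∀ x y, fderiv ℝ (fderiv ℝ v) b y (Mᵀ *ᵥ x) =
      fderiv ℝ (fderiv ℝ v) b (Mᵀ *ᵥ y) x) :
    AnalyticOnNhd ℝ v U ∧ IsComponentOfAAnalyticOn (MatAlg Mᵀ) v U := by
  have : Nonempty (Fin n) := ⟨⟨0, hn⟩⟩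
  have : IsScalarTower ℝ (MatAlg Mᵀ) (Fin n → ℝ) := ⟨fun r a x => by
    simp only [MatAlg.smul_eq_mulVec]
    exact Matrix.smul_mulVec _ _ _⟩
  obtain ⟨J, hJ⟩ := MatAlg.exists_mul_self_eq_neg_one hM
  obtain ⟨ψ, Φ, hΦ, hψ⟩ := exists_frobenius_form Mᵀ
  obtain ⟨hvan, f, hf, hvf⟩ := exists_isAAnalyticOn_of_fderiv_fderiv_smul ψ Φ hΦ hψ hJ hUo hUc hv
    fun b hb a x y => MatAlg.apply_smul_eq _ (hS b hb) a x y
  exact ⟨hvan, f, ψ, hf, hvf⟩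

end Matrix

/-! ### The counterexample and the equivalence. -/

/-- `expNegInvGlue` is not analytic at the origin. -/
theorem not_analyticAt_expNegInvGlue : ¬ AnalyticAt ℝ expNegInvGlue 0 := by
  intro h
  rcases h.eventually_eq_zero_or_eventually_ne_zero with h | h
  · obtain ⟨ε, hε, hs⟩ := Metric.eventually_nhds_iff.1 h
    have h1 : expNegInvGlue (ε / 2) = 0 := hs (by
      rw [Real.dist_eq, sub_zero, abs_of_pos (by positivity)]; linarith)
    exact (expNegInvGlue.pos_of_pos (by positivity : 0 < ε / 2)).ne' h1
  · rw [eventually_nhdsWithin_iff] at h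
    obtain ⟨ε, hε, hs⟩ := Metric.eventually_nhds_iff.1 h
    refine hs (y := -(ε / 2)) ?_ ?_ (expNegInvGlue.zero_of_nonpos (by linarith))
    · rw [Real.dist_eq, sub_zero, abs_neg, abs_of_pos (by positivity)]; linarith
    · simpa using hε.ne'

theorem theoremT {n : ℕ} (hn : 1 ≤ n) (M : Matrix (Fin n) (Fin n) ℝ)
    (U : Set (Fin n → ℝ)) (hUo : IsOpen U) (hUc : IsSimplyConnected U) :
    (∀ v w : (Fin n → ℝ) → ℝ, ContDiffOn ℝ 2 v U → ContDiffOn ℝ 2 w U →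
      (∀ b ∈ U, ∀ x : Fin n → ℝ, fderiv ℝ w b x = fderiv ℝ v b (Mᵀ *ᵥ x)) →
      (AnalyticOnNhd ℝ v U ∧ AnalyticOnNhd ℝ w U) ∧
      (IsComponentOfAAnalyticOn (MatAlg Mᵀ) v U ∧ IsComponentOfAAnalyticOn (MatAlg Mᵀ) w U)) ↔
    ¬ ∃ μ : ℝ, Module.End.HasEigenvalue (Matrix.toLin' M) μ := by
  constructor
  · rintro h ⟨μ, hμ⟩
    obtain ⟨u, hu⟩ := hμ.exists_hasEigenvector
    have hMu : M *ᵥ u = μ • u := by simpa using hu.apply_eq_smul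
    obtain ⟨b₀, hb₀⟩ := hUc.nonempty
    let l : (Fin n → ℝ) →L[ℝ] ℝ := LinearMap.toContinuousLinearMap (dotProductBilin ℝ ℝ u)
    have hl : ∀ x, l x = u ⬝ᵥ x := fun x => rfl
    have hlM : ∀ x, l (Mᵀ *ᵥ x) = μ * l x := fun x => by
      rw [hl, hl, Matrix.dotProduct_mulVec, Matrix.vecMul_transpose, hMu, smul_dotProduct,
        smul_eq_mul]
    -- The shift places the non-analytic point of `expNegInvGlue` at `b₀ ∈ U`.
    let v : (Fin n → ℝ) → ℝ := fun b => expNegInvGlue (l b - l b₀)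
    have hv : ContDiff ℝ 2 v := expNegInvGlue.contDiff.comp (l.contDiff.sub contDiff_const)
    have hvd : ∀ b x, fderiv ℝ v b x = deriv expNegInvGlue (l b - l b₀) * l x := by
      intro b x
      have h1 : HasDerivAt expNegInvGlue (deriv expNegInvGlue (l b - l b₀)) (l b - l b₀) :=
        ((expNegInvGlue.contDiff (n := 1)).differentiable (by simp) _).hasDerivAt
      have h2 := h1.comp_hasFDerivAt b (l.hasFDerivAt.sub_const (l b₀))
      rw [show fderiv ℝ v b = _ from h2.fderiv]
      rfl
    have hw : ∀ b x, fderiv ℝ (fun b => μ * v b) b x = fderiv ℝ v b (Mᵀ *ᵥ x) := by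
      intro b x
      rw [fderiv_const_mul (hv.differentiable (by simp) b)]
      simp only [smul_apply, smul_eq_mul]
      rw [hvd, hvd, hlM]
      ring
    have hva : AnalyticAt ℝ v b₀ := (h v (fun b => μ * v b) hv.contDiffOn
      (contDiff_const.mul hv).contDiffOn (fun b _ x => hw b x)).1.1 b₀ hb₀
    have huu : u ⬝ᵥ u ≠ 0 := fun h0 => hu.2 (dotProduct_self_eq_zero.1 h0)
    -- Along this line `l b - l b₀ = t`, so `v` restricts to `expNegInvGlue` itself.
    have hline : AnalyticAt ℝ (fun t : ℝ => b₀ + t • ((u ⬝ᵥ u)⁻¹ • u)) 0 :=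
      analyticAt_const.add (analyticAt_id.smul analyticAt_const)
    have hcomp : AnalyticAt ℝ (fun t : ℝ => v (b₀ + t • ((u ⬝ᵥ u)⁻¹ • u))) 0 :=
      AnalyticAt.fun_comp (by simpa using hva) hline
    refine not_analyticAt_expNegInvGlue ?_
    convert hcomp using 2 with t
    simp only [v, map_add, map_smul, smul_eq_mul]
    rw [hl u, inv_mul_cancel₀ huu]
    simp
  · intro hM v w hv hw hvw
    have hsv : ∀ b ∈ U, IsSymmSndFDerivAt ℝ v b := fun b hb =>
      (hv.contDiffAt (hUo.mem_nhds hb)).isSymmSndFDerivAt (by simp)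
    have hsw : ∀ b ∈ U, IsSymmSndFDerivAt ℝ w b := fun b hb =>
      (hw.contDiffAt (hUo.mem_nhds hb)).isSymmSndFDerivAt (by simp)
    have hwv : ∀ b ∈ U, ∀ x y, fderiv ℝ (fderiv ℝ w) b y x =
        fderiv ℝ (fderiv ℝ v) b y (Mᵀ *ᵥ x) := by
      intro b hb x y
      have hd : ∀ {g : (Fin n → ℝ) → ℝ}, ContDiffOn ℝ 2 g U →
          HasFDerivAt (fderiv ℝ g) (fderiv ℝ (fderiv ℝ g) b) b := fun hg =>
        (((hg.contDiffAt (hUo.mem_nhds hb)).fderiv_right (m := 1) (by norm_num)).differentiableAt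
          (by simp)).hasFDerivAt
      have h1 := (hd hw).clm_apply (hasFDerivAt_const x b)
      have h2 := (hd hv).clm_apply (hasFDerivAt_const (Mᵀ *ᵥ x) b)
      have h3 := h1.unique (h2.congr_of_eventuallyEq (by
        filter_upwards [hUo.mem_nhds hb] with c hc using hvw c hc x))
      simpa using congrArg (fun L => L y) h3
    -- Symmetry of `D²w`, rewritten through `D²v`, is the selfadjointness of `Mᵀ`.
    have hSv : ∀ b ∈ U, ∀ x y, fderiv ℝ (fderiv ℝ v) b y (Mᵀ *ᵥ x) =
        fderiv ℝ (fderiv ℝ v) b (Mᵀ *ᵥ y) x := by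
      intro b hb x y
      rw [← hwv b hb, (hsw b hb).eq, hwv b hb, (hsv b hb).eq]
    have hSw : ∀ b ∈ U, ∀ x y, fderiv ℝ (fderiv ℝ w) b y (Mᵀ *ᵥ x) =
        fderiv ℝ (fderiv ℝ w) b (Mᵀ *ᵥ y) x := by
      intro b hb x y
      rw [hwv b hb, hwv b hb, hSv b hb]
    have h1 := MatAlg.analyticOnNhd_and_isComponent hn hM hUo hUc hv hSv
    have h2 := MatAlg.analyticOnNhd_and_isComponent hn hM hUo hUc hw hSw
    exact ⟨⟨h1.1, h2.1⟩, h1.2, h2.2⟩
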